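/- Let $X=[x_1,\dots,x_d]$ be a random vector in $\mathbb{R}^d$ with mean $\mu=\mathbb{E}[X]$, let $X_1,X_2,\dots$ be i.i.d. copies of $X$, and put $S_0=0$, $S_n=X_1+\cdots+X_n$. Let $0\le N_0<N_1<N_2<\cdots$ be integers, $\mathscr N=\{N_1,N_2,\dots\}$, and let $\mathscr R\subseteq[0,\infty)\times\mathbb{R}^d$. Define $$\boldsymbol N=\inf\{n\in\mathscr N:(n,S_n)\notin\mathscr R\},\qquad \boldsymbol M=\sup\{N_\ell:\ \ell\ge 0,\ \boldsymbol N>N_\ell\}$$ (with $\inf\emptyset=\infty$). For vectors, products, absolute values, powers, $v^+=\max(0,v)$ and $v^-=\max(0,-v)$ are taken coordinatewise; $\overline{\mathscr R}$ and $\partial\mathscr R$ denote closure and boundary. Assume: (I) $\lambda>0$ and $K$ are real numbers with $N_{\ell+1}\le\lambda N_\ell+K$ for all $\ell\ge0$; (II) $\limsup_{\ell\to\infty}(N_{\ell+1}-N_\ell)<\infty$ or $\liminf_{\ell\to\infty}N_{\ell+1}/N_\ell>1$; (III) $\overline{\mathscr R}$ is convex and contains $(0,\boldsymbol 0)$; (IV)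 $(N_0,S_{N_0})\in\overline{\mathscr R}$ almost surely; (V) $m$ is the unique positive number with $(m,m\mu)\in\partial\mathscr R$; (VI) each coordinate of $\mathbb{E}[|X|^3]$ is finite. Let $A\in\mathbb{R}^d$ and $B,C\in\mathbb{R}$ with $C>0$ be such that the hyperplane $\{(t,s): A\cdot s+Bt=C\}$ is a supporting hyperplane of $\mathscr R$ passing through the boundary point $(m,m\mu)$. Define $$\alpha=\mu-\lambda\,\mathbb{E}[(X-\mu)^+],\quad \beta=\mu+\lambda\,\mathbb{E}[(X-\mu)^-],\quad \zeta=(N_0-K)\,\mathbb{E}[(X-\mu)^+],\quad \eta=(K-N_0)\,\mathbb{E}[(X-\mu)^-].$$ If $\min_{q\in\{0,1\}^d}\bigl(B+A\cdot[\beta+q(\alpha-\beta)]\bigr)>0$, then $$\mathbb{E}[\boldsymbol M]\le\max_{q\in\{0,1\}^d}\frac{C-A\cdot[\eta+q(\zeta-\eta)]}{B+A\cdot[\beta+q(\alpha-\beta)]};$$ in particular $\mathbb{E}[\boldsymbol M]<\infty$. -/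

import Mathlib

open MeasureTheory ProbabilityTheory Filter
open scoped ENNReal

noncomputable section

namespace ConvexStopping

/-- The sample sum `S_n = X_1 + ⋯ + X_n` (with `S_0 = 0`); the `i`-th sample, `i ≥ 1`, is
`Xs (i - 1)`. -/
def sampleSum {Ω : Type*} {d : ℕ} (Xs : ℕ → Ω → Fin d → ℝ) (n : ℕ) (ω : Ω) : Fin d → ℝ :=
  ∑ i ∈ Finset.range n, Xs i ω

/-- Coordinatewise expectation of a random vector. -/
def expect {Ω : Type*} [MeasurableSpace Ω] (P : Measure Ω) {d : ℕ} (Y : Ω → Fin d → ℝ) :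
    Fin d → ℝ :=
  fun j => ∫ ω, Y ω j ∂P

/-- The stopping time `inf {n ∈ {N_1, N_2, …} : (n, S_n) ∉ R}`, with the value `⊤` if there is
no such `n`. -/
def stopTime {Ω : Type*} {d : ℕ} (Ns : ℕ → ℕ) (R : Set (ℝ × (Fin d → ℝ)))
    (Xs : ℕ → Ω → Fin d → ℝ) (ω : Ω) : ℕ∞ :=
  sInf {n : ℕ∞ | ∃ l : ℕ, 1 ≤ l ∧ n = (Ns l : ℕ∞) ∧
    ((Ns l : ℝ), sampleSum Xs (Ns l) ω) ∉ R}

/-- `sup {N_l : l ≥ 0, stopTime > N_l}`: the last sampling stage before stopping. -/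
def lastBefore {Ω : Type*} {d : ℕ} (Ns : ℕ → ℕ) (R : Set (ℝ × (Fin d → ℝ)))
    (Xs : ℕ → Ω → Fin d → ℝ) (ω : Ω) : ℕ∞ :=
  sSup {n : ℕ∞ | ∃ l : ℕ, n = (Ns l : ℕ∞) ∧ (Ns l : ℕ∞) < stopTime Ns R Xs ω}

/-- The set `{(t, s) : A s + B t = C}` is a hyperplane that supports `R` at the boundary
point `p`: it passes through `p`, and `R` lies in one of its two closed half-spaces. -/
structure IsSupportingHyperplaneAt {d : ℕ} (A : Fin d → ℝ) (B C : ℝ)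
    (R : Set (ℝ × (Fin d → ℝ))) (p : ℝ × (Fin d → ℝ)) : Prop where
  nondegenerate : A ≠ 0 ∨ B ≠ 0
  mem_frontier : p ∈ frontier R
  passes : A ⬝ᵥ p.2 + B * p.1 = C
  one_side : (∀ x ∈ R, A ⬝ᵥ x.2 + B * x.1 ≤ C) ∨ (∀ x ∈ R, C ≤ A ⬝ᵥ x.2 + B * x.1)

/-- The vertices `{0, 1}^d` of the unit cube. -/
def cubeVertices (d : ℕ) : Finset (Fin d → ℝ) :=
  Fintype.piFinset fun _ => ({0, 1} : Finset ℝ)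

theorem cubeVertices_nonempty (d : ℕ) : (cubeVertices d).Nonempty :=
  ⟨fun _ => 0, by simp [cubeVertices, Fintype.mem_piFinset]⟩

end ConvexStopping

end

open ConvexStopping

/-! Let `L = lastStage k` be the last surviving stage up to `k`. The point `(N_L, S_{N_L})` lies in
the closure of `R` almost surely, so `A·S_{N_L} + B N_L ≤ C`, and the same holds for expectations
(`hEle`). Since `N_L` is not a stopping time, Wald's identity fails for it, and the error has to be
bounded (`integral_sum_lastStage_le`). The block of samples from `N_l` to `N_{l+1}` enters `S_{N_L}`
only on survival through `l+1`, an event which depends on that block. Replacing each centered sample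
by its positive part allows enlarging the event to survival through `l`, which is independent of the
block. The resulting sum is at most `E[(X_j-μ_j)^+] (E[N_{L+1}] - N_0)`, and the growth condition
gives `E[N_{L+1}] ≤ λ E[N_L] + K`. The same argument for the negated samples gives the other side.
Thus `E[S_{N_L}]` lies in a box whose faces are affine in `E[N_L]`. Minimizing `A·s` over the box
selects a vertex `q` and leaves a linear inequality for `E[N_L]`, with a bound free of `k`. Monotone
convergence in `k` finishes. -/

namespace ConvexStopping

/-! ### Survival events and the truncated last stage. -/

variable {Ω : Type*} {d : ℕ}

/-- The event that sampling has not stopped at any of the stages `1, …, l`. -/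
def survivalSet (Ns : ℕ → ℕ) (R : Set (ℝ × (Fin d → ℝ))) (Xs : ℕ → Ω → Fin d → ℝ) (l : ℕ) :
    Set Ω :=
  {ω | ∀ j, 1 ≤ j → j ≤ l → ((Ns j : ℝ), sampleSum Xs (Ns j) ω) ∈ R}

theorem survivalSet_zero (Ns : ℕ → ℕ) (R : Set (ℝ × (Fin d → ℝ))) (Xs : ℕ → Ω → Fin d → ℝ) :
    survivalSet Ns R Xs 0 = Set.univ := by
  ext ω
  simp only [survivalSet, Set.mem_ofPred_eq, Set.mem_univ, iff_true]
  omega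

theorem survivalSet_antitone (Ns : ℕ → ℕ) (R : Set (ℝ × (Fin d → ℝ)))
    (Xs : ℕ → Ω → Fin d → ℝ) : Antitone (survivalSet Ns R Xs) :=
  fun _ _ hab _ h j h1 hj => h j h1 (hj.trans hab)

theorem lt_stopTime_iff {Ns : ℕ → ℕ} (hNs : StrictMono Ns) (R : Set (ℝ × (Fin d → ℝ)))
    (Xs : ℕ → Ω → Fin d → ℝ) (l : ℕ) (ω : Ω) :
    (Ns l : ℕ∞) < stopTime Ns R Xs ω ↔ ω ∈ survivalSet Ns R Xs l := by
  constructor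
  · intro h j h1 hj
    by_contra hn
    have h2 : stopTime Ns R Xs ω ≤ (Ns j : ℕ∞) := sInf_le ⟨j, h1, rfl, hn⟩
    have h3 : (Ns j : ℕ∞) ≤ Ns l := by exact_mod_cast hNs.monotone hj
    exact absurd (h.trans_le (h2.trans h3)) (lt_irrefl _)
  · intro h
    have h1 : ((Ns (l + 1) : ℕ) : ℕ∞) ≤ stopTime Ns R Xs ω := by
      refine le_sInf ?_
      rintro n ⟨j, hj1, rfl, hj⟩
      have : l < j := by
        by_contra hl
        exact hj (h j hj1 (not_lt.1 hl))
      exact_mod_cast hNs.monotone (Nat.succ_le_of_lt this)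
    refine lt_of_lt_of_le ?_ h1
    exact_mod_cast hNs (Nat.lt_succ_self l)

open Classical in
/-- The last index `l ≤ k` such that sampling has not stopped at the stages `1, …, l`. -/
noncomputable def lastStage (Ns : ℕ → ℕ) (R : Set (ℝ × (Fin d → ℝ)))
    (Xs : ℕ → Ω → Fin d → ℝ) (k : ℕ) (ω : Ω) : ℕ :=
  Nat.findGreatest (fun l => ω ∈ survivalSet Ns R Xs l) k

theorem lastStage_le (Ns : ℕ → ℕ) (R : Set (ℝ × (Fin d → ℝ))) (Xs : ℕ → Ω → Fin d → ℝ)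
    (k : ℕ) (ω : Ω) : lastStage Ns R Xs k ω ≤ k := by
  classical exact Nat.findGreatest_le k

theorem mem_survivalSet_lastStage (Ns : ℕ → ℕ) (R : Set (ℝ × (Fin d → ℝ)))
    (Xs : ℕ → Ω → Fin d → ℝ) (k : ℕ) (ω : Ω) :
    ω ∈ survivalSet Ns R Xs (lastStage Ns R Xs k ω) := by
  classical
  exact Nat.findGreatest_spec (P := fun l => ω ∈ survivalSet Ns R Xs l) (Nat.zero_le k)
    (by simp [survivalSet_zero])

theorem lastStage_of_mem {Ns : ℕ → ℕ} {R : Set (ℝ × (Fin d → ℝ))} {Xs : ℕ → Ω → Fin d → ℝ}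
    {k : ℕ} {ω : Ω} (h : ω ∈ survivalSet Ns R Xs k) : lastStage Ns R Xs k ω = k := by
  classical exact le_antisymm (Nat.findGreatest_le k) (Nat.le_findGreatest le_rfl h)

theorem lastStage_succ_of_notMem {Ns : ℕ → ℕ} {R : Set (ℝ × (Fin d → ℝ))}
    {Xs : ℕ → Ω → Fin d → ℝ} {k : ℕ} {ω : Ω} (h : ω ∉ survivalSet Ns R Xs (k + 1)) :
    lastStage Ns R Xs (k + 1) ω = lastStage Ns R Xs k ω := by
  classical exact Nat.findGreatest_of_not h

theorem lastStage_monotone (Ns : ℕ → ℕ) (R : Set (ℝ × (Fin d → ℝ)))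
    (Xs : ℕ → Ω → Fin d → ℝ) (ω : Ω) : Monotone fun k => lastStage Ns R Xs k ω := by
  classical
  exact fun _ _ h => Nat.findGreatest_mono_right _ h

/-- The truncations increase with `k`, so monotone convergence applies even where sampling never
stops. -/
theorem lastBefore_eq_iSup {Ns : ℕ → ℕ} (hNs : StrictMono Ns) (R : Set (ℝ × (Fin d → ℝ)))
    (Xs : ℕ → Ω → Fin d → ℝ) (ω : Ω) :
    lastBefore Ns R Xs ω = ⨆ k, (Ns (lastStage Ns R Xs k ω) : ℕ∞) := by
  apply le_antisymm
  · refine sSup_le ?_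
    rintro n ⟨l, rfl, hl⟩
    rw [lt_stopTime_iff hNs] at hl
    refine le_iSup_of_le l ?_
    rw [lastStage_of_mem hl]
  · refine iSup_le fun k => le_sSup ⟨_, rfl, ?_⟩
    rw [lt_stopTime_iff hNs]
    exact mem_survivalSet_lastStage Ns R Xs k ω

/-- Telescoping a sequence up to the last stage before stopping. -/
theorem apply_lastStage_eq_sum (Ns : ℕ → ℕ) (R : Set (ℝ × (Fin d → ℝ)))
    (Xs : ℕ → Ω → Fin d → ℝ) (v : ℕ → ℝ) (k : ℕ) (ω : Ω) :
    v (lastStage Ns R Xs k ω) = v 0 + ∑ l ∈ Finset.range k,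
      (survivalSet Ns R Xs (l + 1)).indicator (fun _ => v (l + 1) - v l) ω := by
  induction k with
  | zero => simp [Nat.le_zero.1 (lastStage_le Ns R Xs 0 ω)]
  | succ k ih =>
    rw [Finset.sum_range_succ, ← add_assoc, ← ih]
    by_cases h : ω ∈ survivalSet Ns R Xs (k + 1)
    · rw [Set.indicator_of_mem h, lastStage_of_mem h,
        lastStage_of_mem (survivalSet_antitone Ns R Xs (Nat.le_succ k) h)]
      ring
    · rw [Set.indicator_of_notMem h, lastStage_succ_of_notMem h, add_zero]

/-- Survival up to stage `l` is decided by the first `Ns l` samples. -/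
theorem exists_survivalSet_eq_preimage {Ns : ℕ → ℕ} (hNs : Monotone Ns)
    {R : Set (ℝ × (Fin d → ℝ))}
    (hR : ∀ l, 1 ≤ l → MeasurableSet {s : Fin d → ℝ | ((Ns l : ℝ), s) ∈ R})
    (Xs : ℕ → Ω → Fin d → ℝ) (l : ℕ) :
    ∃ T : Set (Finset.range (Ns l) → Fin d → ℝ), MeasurableSet T ∧
      survivalSet Ns R Xs l = (fun ω (i : Finset.range (Ns l)) => Xs i ω) ⁻¹' T := by
  -- The default `0` is never reached for `j ≤ l`, the only indices used.
  let σ : ℕ → (Finset.range (Ns l) → Fin d → ℝ) → Fin d → ℝ := fun j x =>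
    ∑ i ∈ Finset.range (Ns j), if h : i ∈ Finset.range (Ns l) then x ⟨i, h⟩ else 0
  have hσ : ∀ j, Measurable (σ j) := by
    intro j
    refine Finset.measurable_sum _ fun i _ => ?_
    by_cases h : i ∈ Finset.range (Ns l)
    · simp only [h, dite_true]
      exact measurable_pi_apply _
    · simp only [h, dite_false]
      exact measurable_const
  have hσ' : ∀ j ≤ l, ∀ ω, σ j (fun i => Xs i ω) = sampleSum Xs (Ns j) ω := by
    intro j hj ω
    refine Finset.sum_congr rfl fun i hi => ?_
    have : i ∈ Finset.range (Ns l) :=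
      Finset.mem_range.2 ((Finset.mem_range.1 hi).trans_le (hNs hj))
    simp only [this, dite_true]
  refine ⟨⋂ j ∈ Finset.Icc 1 l, σ j ⁻¹' {s | ((Ns j : ℝ), s) ∈ R},
    Finset.measurableSet_biInter _ fun j hj => hσ j (hR j (Finset.mem_Icc.1 hj).1), ?_⟩
  ext ω
  simp only [survivalSet, Set.mem_ofPred_eq, Set.mem_preimage, Set.mem_iInter, Finset.mem_Icc]
  constructor
  · rintro h j ⟨h1, hj⟩
    rw [hσ' j hj]
    exact h j h1 hj
  · intro h j h1 hj
    rw [← hσ' j hj]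
    exact h j ⟨h1, hj⟩

/-! ### Measurability, integrability and independence. -/

variable [MeasurableSpace Ω]

theorem measurableSet_survivalSet {Ns : ℕ → ℕ} (hNs : Monotone Ns) {R : Set (ℝ × (Fin d → ℝ))}
    (hR : ∀ l, 1 ≤ l → MeasurableSet {s : Fin d → ℝ | ((Ns l : ℝ), s) ∈ R})
    {Xs : ℕ → Ω → Fin d → ℝ} (hXs : ∀ i, Measurable (Xs i)) (l : ℕ) :
    MeasurableSet (survivalSet Ns R Xs l) := by
  obtain ⟨T, hT, h⟩ := exists_survivalSet_eq_preimage hNs hR Xs l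
  rw [h]
  exact measurableSet_preimage (measurable_pi_iff.2 fun i => hXs i) hT

theorem measurable_lastStage {Ns : ℕ → ℕ} (hNs : Monotone Ns) {R : Set (ℝ × (Fin d → ℝ))}
    (hR : ∀ l, 1 ≤ l → MeasurableSet {s : Fin d → ℝ | ((Ns l : ℝ), s) ∈ R})
    {Xs : ℕ → Ω → Fin d → ℝ} (hXs : ∀ i, Measurable (Xs i)) (k : ℕ) :
    Measurable (lastStage Ns R Xs k) := by
  classical
  exact measurable_findGreatest fun l _ => measurableSet_survivalSet hNs hR hXs l

/-- Telescoping writes the composite as a finite sum of integrable functions cut off by survival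
events. -/
theorem integrable_comp_lastStage {P : Measure Ω} [IsFiniteMeasure P] {Ns : ℕ → ℕ}
    (hNs : Monotone Ns) {R : Set (ℝ × (Fin d → ℝ))}
    (hR : ∀ l, 1 ≤ l → MeasurableSet {s : Fin d → ℝ | ((Ns l : ℝ), s) ∈ R})
    {Xs : ℕ → Ω → Fin d → ℝ} (hXs : ∀ i, Measurable (Xs i)) (v : ℕ → Ω → ℝ)
    (hv : ∀ l, Integrable (v l) P) (k : ℕ) :
    Integrable (fun ω => v (lastStage Ns R Xs k ω) ω) P := by
  have h : (fun ω => v (lastStage Ns R Xs k ω) ω) = fun ω => v 0 ω + ∑ l ∈ Finset.range k,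
      (survivalSet Ns R Xs (l + 1)).indicator (fun ω => v (l + 1) ω - v l ω) ω :=
    funext fun ω => apply_lastStage_eq_sum Ns R Xs (fun l => v l ω) k ω
  rw [h]
  exact (hv 0).add (integrable_finsetSum _ fun l _ =>
    ((hv (l + 1)).sub (hv l)).indicator (measurableSet_survivalSet hNs hR hXs (l + 1)))

/-- A sample taken after stage `l` is independent of survival up to stage `l`. -/
theorem integral_indicator_survivalSet {P : Measure Ω} {Ns : ℕ → ℕ}
    (hNs : Monotone Ns) {R : Set (ℝ × (Fin d → ℝ))}
    (hR : ∀ l, 1 ≤ l → MeasurableSet {s : Fin d → ℝ | ((Ns l : ℝ), s) ∈ R})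
    {Xs : ℕ → Ω → Fin d → ℝ} (hXs : ∀ i, Measurable (Xs i)) (hindep : iIndepFun Xs P)
    {f : (Fin d → ℝ) → ℝ} (hf : Measurable f) {l i : ℕ} (hi : Ns l ≤ i) :
    ∫ ω, (survivalSet Ns R Xs l).indicator (fun ω => f (Xs i ω)) ω ∂P =
      P.real (survivalSet Ns R Xs l) * ∫ ω, f (Xs i ω) ∂P := by
  have hmeas := measurableSet_survivalSet hNs hR hXs l
  obtain ⟨T, hT, h⟩ := exists_survivalSet_eq_preimage hNs hR Xs l
  have hdisj : Disjoint (Finset.range (Ns l)) {i} := by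
    simpa using hi
  have hone : Measurable (T.indicator fun _ => (1 : ℝ)) := measurable_const.indicator hT
  have hind := (hindep.indepFun_finset _ _ hdisj hXs).comp
    (φ := T.indicator fun _ => (1 : ℝ))
    (ψ := fun x : ({i} : Finset ℕ) → Fin d → ℝ => f (x ⟨i, Finset.mem_singleton_self i⟩))
    hone (hf.comp (measurable_pi_apply _))
  have hind' : IndepFun ((survivalSet Ns R Xs l).indicator fun _ => (1 : ℝ))
      (fun ω => f (Xs i ω)) P := by
    rw [h]
    exact hind
  have := hind'.integral_fun_mul_eq_mul_integral
    (measurable_const.indicator hmeas).aestronglyMeasurable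
    (hf.comp (hXs i)).aestronglyMeasurable
  rw [integral_indicator_const _ hmeas, smul_eq_mul, mul_one] at this
  rw [← this]
  congr 1 with ω
  by_cases hω : ω ∈ survivalSet Ns R Xs l <;> simp [hω]

/-! ### Expectations at the last stage and the one after it. -/

/-- Moving one stage past the last makes the block from `N_l` to `N_{l+1}` count on survival through
`l` instead of `l+1`, which are the weights produced by the independence argument. -/
theorem integral_apply_lastStage_succ {P : Measure Ω} [IsProbabilityMeasure P] {Ns : ℕ → ℕ}
    (hNs : Monotone Ns) {R : Set (ℝ × (Fin d → ℝ))}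
    (hR : ∀ l, 1 ≤ l → MeasurableSet {s : Fin d → ℝ | ((Ns l : ℝ), s) ∈ R})
    {Xs : ℕ → Ω → Fin d → ℝ} (hXs : ∀ i, Measurable (Xs i)) (k : ℕ) :
    ∫ ω, (Ns (lastStage Ns R Xs k ω + 1) : ℝ) ∂P = Ns 0 + ∑ l ∈ Finset.range (k + 1),
      P.real (survivalSet Ns R Xs l) * ((Ns (l + 1) : ℝ) - Ns l) := by
  have hmeas := measurableSet_survivalSet hNs hR hXs
  have h : ∀ ω, (Ns (lastStage Ns R Xs k ω + 1) : ℝ) = Ns 1 + ∑ l ∈ Finset.range k,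
      (survivalSet Ns R Xs (l + 1)).indicator
        (fun _ => (Ns (l + 1 + 1) : ℝ) - Ns (l + 1)) ω :=
    fun ω => apply_lastStage_eq_sum Ns R Xs (fun l => (Ns (l + 1) : ℝ)) k ω
  simp_rw [h]
  rw [integral_add (integrable_const _) (integrable_finsetSum _ fun l _ =>
    (integrable_const _).indicator (hmeas _)), integral_finsetSum _ fun l _ =>
    (integrable_const _).indicator (hmeas _), Finset.sum_range_succ', survivalSet_zero]
  simp only [integral_indicator_const _ (hmeas _), smul_eq_mul, integral_const, probReal_univ,
    zero_add]
  ring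

/-- The partial sums of a centered function of the samples, evaluated at the last stage before
stopping, are bounded in mean by the expected number of samples needed to stop. -/
theorem integral_sum_lastStage_le {P : Measure Ω} [IsProbabilityMeasure P] {Ns : ℕ → ℕ}
    (hNs : Monotone Ns) {R : Set (ℝ × (Fin d → ℝ))}
    (hR : ∀ l, 1 ≤ l → MeasurableSet {s : Fin d → ℝ | ((Ns l : ℝ), s) ∈ R})
    {Xs : ℕ → Ω → Fin d → ℝ} (hXs : ∀ i, Measurable (Xs i)) (hindep : iIndepFun Xs P)
    {f : (Fin d → ℝ) → ℝ} (hf : Measurable f) (hint : ∀ i, Integrable (fun ω => f (Xs i ω)) P)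
    (hzero : ∀ i, ∫ ω, f (Xs i ω) ∂P = 0) {a : ℝ}
    (ha : ∀ i, ∫ ω, max 0 (f (Xs i ω)) ∂P = a) (k : ℕ) :
    ∫ ω, ∑ i ∈ Finset.range (Ns (lastStage Ns R Xs k ω)), f (Xs i ω) ∂P ≤
      a * (∫ ω, (Ns (lastStage Ns R Xs k ω + 1) : ℝ) ∂P - Ns 0) := by
  have hmeas := measurableSet_survivalSet hNs hR hXs
  have ha0 : 0 ≤ a := by
    rw [← ha 0]
    exact integral_nonneg fun ω => le_max_left _ _
  have hint' : ∀ i, Integrable (fun ω => max 0 (f (Xs i ω))) P := fun i => by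
    simpa only [max_comm] using (hint i).pos_part
  have hintI : ∀ l i, Integrable
      ((survivalSet Ns R Xs l).indicator fun ω => max 0 (f (Xs i ω))) P :=
    fun l i => (hint' i).indicator (hmeas l)
  have hpt : ∀ ω, ∑ i ∈ Finset.range (Ns (lastStage Ns R Xs k ω)), f (Xs i ω) ≤
      ∑ i ∈ Finset.range (Ns 0), f (Xs i ω) + ∑ l ∈ Finset.range k,
        ∑ i ∈ Finset.Ico (Ns l) (Ns (l + 1)),
          (survivalSet Ns R Xs l).indicator (fun ω => max 0 (f (Xs i ω))) ω := by
    intro ω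
    rw [apply_lastStage_eq_sum Ns R Xs (fun l => ∑ i ∈ Finset.range (Ns l), f (Xs i ω)) k ω]
    gcongr with l hl
    rw [← Finset.sum_Ico_eq_sub _ (hNs (Nat.le_succ l))]
    -- Passing to positive parts makes the added terms nonnegative, so the event may grow from
    -- survival through `l+1` to survival through `l`.
    by_cases h : ω ∈ survivalSet Ns R Xs (l + 1)
    · have h' := survivalSet_antitone Ns R Xs (Nat.le_succ l) h
      simp only [Set.indicator_of_mem h, Set.indicator_of_mem h']
      exact Finset.sum_le_sum fun i _ => le_max_right _ _
    · rw [Set.indicator_of_notMem h]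
      exact Finset.sum_nonneg fun i _ => Set.indicator_nonneg (fun ω _ => le_max_left _ _) ω
  calc
    _ ≤ ∫ ω, (∑ i ∈ Finset.range (Ns 0), f (Xs i ω) + ∑ l ∈ Finset.range k,
        ∑ i ∈ Finset.Ico (Ns l) (Ns (l + 1)),
          (survivalSet Ns R Xs l).indicator (fun ω => max 0 (f (Xs i ω))) ω) ∂P := by
      refine integral_mono ?_ ?_ hpt
      · exact integrable_comp_lastStage hNs hR hXs
          (fun l ω => ∑ i ∈ Finset.range (Ns l), f (Xs i ω))
          (fun l => integrable_finsetSum _ fun i _ => hint i) k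
      · exact (integrable_finsetSum _ fun i _ => hint i).add
          (integrable_finsetSum _ fun l _ => integrable_finsetSum _ fun i _ => hintI l i)
    _ = ∑ l ∈ Finset.range k, ∑ i ∈ Finset.Ico (Ns l) (Ns (l + 1)),
          P.real (survivalSet Ns R Xs l) * a := by
      rw [integral_add (integrable_finsetSum _ fun i _ => hint i)
        (integrable_finsetSum _ fun l _ => integrable_finsetSum _ fun i _ => hintI l i),
        integral_finsetSum _ fun i _ => hint i,
        integral_finsetSum _ fun l _ => integrable_finsetSum _ fun i _ => hintI l i]
      simp only [hzero, Finset.sum_const_zero, zero_add]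
      refine Finset.sum_congr rfl fun l _ => ?_
      rw [integral_finsetSum _ fun i _ => hintI l i]
      refine Finset.sum_congr rfl fun i hi => ?_
      rw [integral_indicator_survivalSet hNs hR hXs hindep (f := fun x => max 0 (f x))
        (measurable_const.max hf) (Finset.mem_Ico.1 hi).1, ha]
    _ = a * ∑ l ∈ Finset.range k,
          P.real (survivalSet Ns R Xs l) * ((Ns (l + 1) : ℝ) - Ns l) := by
      rw [Finset.mul_sum]
      refine Finset.sum_congr rfl fun l _ => ?_
      rw [Finset.sum_const, Nat.card_Ico, nsmul_eq_mul, Nat.cast_sub (hNs (Nat.le_succ l))]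
      ring
    _ ≤ _ := by
      rw [integral_apply_lastStage_succ hNs hR hXs, add_sub_cancel_left]
      refine mul_le_mul_of_nonneg_left ?_ ha0
      -- The formula for `E[N_{L+1}]` has one further term, `l = k`, which is nonnegative.
      rw [Finset.sum_range_succ]
      refine le_add_of_nonneg_right (mul_nonneg measureReal_nonneg (sub_nonneg.2 ?_))
      exact_mod_cast hNs (Nat.le_succ k)

theorem integral_lastStage_succ_le {P : Measure Ω} [IsProbabilityMeasure P] {Ns : ℕ → ℕ}
    (hNs : Monotone Ns) {R : Set (ℝ × (Fin d → ℝ))}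
    (hR : ∀ l, 1 ≤ l → MeasurableSet {s : Fin d → ℝ | ((Ns l : ℝ), s) ∈ R})
    {Xs : ℕ → Ω → Fin d → ℝ} (hXs : ∀ i, Measurable (Xs i)) {lam K : ℝ}
    (hI : ∀ l, (Ns (l + 1) : ℝ) ≤ lam * (Ns l : ℝ) + K) (k : ℕ) :
    ∫ ω, (Ns (lastStage Ns R Xs k ω + 1) : ℝ) ∂P ≤
      lam * ∫ ω, (Ns (lastStage Ns R Xs k ω) : ℝ) ∂P + K := by
  have h1 := integrable_comp_lastStage (P := P) hNs hR hXs (fun l _ => (Ns (l + 1) : ℝ))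
    (fun l => integrable_const _) k
  have h2 := integrable_comp_lastStage (P := P) hNs hR hXs (fun l _ => (Ns l : ℝ))
    (fun l => integrable_const _) k
  calc
    _ ≤ ∫ ω, (lam * (Ns (lastStage Ns R Xs k ω) : ℝ) + K) ∂P :=
      integral_mono h1 ((h2.const_mul lam).add (integrable_const K)) fun ω => hI _
    _ = _ := by
      rw [integral_add (h2.const_mul lam) (integrable_const K), integral_const_mul]
      simp

/-! ### The supporting half-space and linear forms on boxes. -/

/-- The linear form vanishes at the origin, which lies in the closure; as `0 < C`, this excludes the
opposite half-space. -/
theorem IsSupportingHyperplaneAt.le_of_mem_closure {A : Fin d → ℝ} {B C : ℝ}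
    {R : Set (ℝ × (Fin d → ℝ))} {p : ℝ × (Fin d → ℝ)} (hH : IsSupportingHyperplaneAt A B C R p)
    (hC : 0 < C) (h0 : ((0 : ℝ), (0 : Fin d → ℝ)) ∈ closure R) {x : ℝ × (Fin d → ℝ)}
    (hx : x ∈ closure R) : A ⬝ᵥ x.2 + B * x.1 ≤ C := by
  have hcont : Continuous fun x : ℝ × (Fin d → ℝ) => A ⬝ᵥ x.2 + B * x.1 := by
    unfold dotProduct
    fun_prop
  rcases hH.one_side with h | h
  · exact closure_minimal (t := {x : ℝ × (Fin d → ℝ) | A ⬝ᵥ x.2 + B * x.1 ≤ C}) (fun x hx => h x hx)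
      (isClosed_le hcont continuous_const) hx
  · have := closure_minimal (t := {x : ℝ × (Fin d → ℝ) | C ≤ A ⬝ᵥ x.2 + B * x.1})
      (fun x hx => h x hx)
      (isClosed_le continuous_const hcont) h0
    simp only [Set.mem_ofPred_eq, dotProduct_zero, mul_zero, add_zero] at this
    exact absurd this (not_le.2 hC)

/-- A linear form on a box is minimized at a vertex, chosen independently of the size of the
box. -/
theorem exists_cubeVertices_dotProduct_le (A α β ζ η : Fin d → ℝ) :
    ∃ q ∈ cubeVertices d, ∀ (n : ℝ) (s : Fin d → ℝ),
      (∀ j, α j * n + ζ j ≤ s j) → (∀ j, s j ≤ β j * n + η j) →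
        A ⬝ᵥ (β + q * (α - β)) * n + A ⬝ᵥ (η + q * (ζ - η)) ≤ A ⬝ᵥ s := by
  -- The sign of `A j` decides the face: lower bounds (`α`, `ζ`) where `0 ≤ A j`, upper bounds (`β`,
  -- `η`) elsewhere.
  refine ⟨fun j => if 0 ≤ A j then 1 else 0, ?_, fun n s hl hu => ?_⟩
  · simp only [cubeVertices, Fintype.mem_piFinset]
    intro j
    split_ifs <;> simp
  · simp only [dotProduct, Finset.sum_mul, ← Finset.sum_add_distrib]
    refine Finset.sum_le_sum fun j _ => ?_
    simp only [Pi.add_apply, Pi.mul_apply, Pi.sub_apply]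
    split_ifs with h
    · nlinarith [mul_le_mul_of_nonneg_left (hl j) h]
    · nlinarith [mul_le_mul_of_nonpos_left (hu j) (le_of_not_ge h)]

end ConvexStopping

/-! ### The bound on the expectation. -/

theorem theorem14 {Ω : Type*} [MeasurableSpace Ω] (P : Measure Ω) [IsProbabilityMeasure P]
    (d : ℕ)
    -- the random vector `X`, its i.i.d. samples, and its mean
    (X : Ω → Fin d → ℝ) (Xs : ℕ → Ω → Fin d → ℝ)
    (hX : Measurable X) (hXs : ∀ i, Measurable (Xs i))
    (hindep : iIndepFun Xs P) (hident : ∀ i, IdentDistrib (Xs i) X P P)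
    (μ : Fin d → ℝ) (hμ : μ = expect P X)
    -- the sample sizes and the continuity region
    (Ns : ℕ → ℕ) (hNs : StrictMono Ns)
    (R : Set (ℝ × (Fin d → ℝ))) (hR : ∀ x ∈ R, 0 ≤ x.1)
    (hRmeas : ∀ l, 1 ≤ l → MeasurableSet {s : Fin d → ℝ | ((Ns l : ℝ), s) ∈ R})
    -- growth of the sample sizes
    (lam K : ℝ) (hlam : 0 < lam) (hI : ∀ l, (Ns (l + 1) : ℝ) ≤ lam * (Ns l : ℝ) + K)
    -- bounded or geometrically growing increments
    (hII : limsup (fun l => (Ns (l + 1) : ℝ≥0∞) - (Ns l : ℝ≥0∞)) atTop < ⊤ ∨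
      1 < liminf (fun l => (Ns (l + 1) : ℝ≥0∞) / (Ns l : ℝ≥0∞)) atTop)
    -- convexity of the closure of the continuity region
    (hIII : Convex ℝ (closure R)) (hIII' : ((0 : ℝ), (0 : Fin d → ℝ)) ∈ closure R)
    -- sampling starts in the closure of the continuity region
    (hIV : ∀ᵐ ω ∂P, ((Ns 0 : ℝ), sampleSum Xs (Ns 0) ω) ∈ closure R)
    -- the unique boundary point on the mean ray
    (m : ℝ) (hm : 0 < m) (hV : (m, m • μ) ∈ frontier R)
    (hV' : ∀ t : ℝ, 0 < t → (t, t • μ) ∈ frontier R → t = m)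
    -- finite third absolute moments
    (hVI : ∀ j, Integrable (fun ω => |X ω j| ^ 3) P)
    -- the supporting hyperplane
    (A : Fin d → ℝ) (B C : ℝ) (hC : 0 < C)
    (hH : IsSupportingHyperplaneAt A B C R (m, m • μ))
    (α β ζ η : Fin d → ℝ)
    (hα : α = μ - lam • expect P (fun ω j => max 0 (X ω j - μ j)))
    (hβ : β = μ + lam • expect P (fun ω j => max 0 (-(X ω j - μ j))))
    (hζ : ζ = ((Ns 0 : ℝ) - K) • expect P (fun ω j => max 0 (X ω j - μ j)))
    (hη : η = (K - (Ns 0 : ℝ)) • expect P (fun ω j => max 0 (-(X ω j - μ j))))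
    (hpos : 0 < (cubeVertices d).inf' (cubeVertices_nonempty d)
      (fun q => B + A ⬝ᵥ (β + q * (α - β)))) :
    ((∫⁻ ω, (lastBefore Ns R Xs ω : ℝ≥0∞) ∂P : ℝ≥0∞) : EReal) ≤
      (((cubeVertices d).sup' (cubeVertices_nonempty d)
        (fun q => (C - A ⬝ᵥ (η + q * (ζ - η))) / (B + A ⬝ᵥ (β + q * (α - β)))) : ℝ) : EReal) := by
  have hmono := hNs.monotone
  have hle := fun x hx => hH.le_of_mem_closure (x := x) hC hIII' hx
  have hXj : ∀ j, Integrable (fun ω => X ω j) P := by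
    intro j
    have hm' : Measurable fun ω => X ω j := (measurable_pi_apply j).comp hX
    refine ((hVI j).add (integrable_const 1)).mono' hm'.aestronglyMeasurable
      (ae_of_all _ fun ω => ?_)
    rw [Real.norm_eq_abs, Pi.add_apply]
    -- Integrability of `X` comes from `|x| ≤ |x|^3 + 1`.
    nlinarith [abs_nonneg (X ω j), sq_nonneg (|X ω j| - 1)]
  have hid : ∀ j i, IdentDistrib (fun ω => Xs i ω j - μ j) (fun ω => X ω j - μ j) P P :=
    fun j i => (hident i).comp (u := fun x : Fin d → ℝ => x j - μ j)
      ((measurable_pi_apply j).sub_const _)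
  have hXc : ∀ j, Integrable (fun ω => X ω j - μ j) P := fun j =>
    (hXj j).sub (integrable_const _)
  have hXc0 : ∀ j, ∫ ω, (X ω j - μ j) ∂P = 0 := by
    intro j
    rw [integral_sub (hXj j) (integrable_const _)]
    simp [hμ, expect]
  have hXsc : ∀ j i, Integrable (fun ω => Xs i ω j - μ j) P := fun j i =>
    (hid j i).integrable_iff.2 (hXc j)
  have hXsc0 : ∀ j i, ∫ ω, (Xs i ω j - μ j) ∂P = 0 := fun j i =>
    (hid j i).integral_eq.trans (hXc0 j)
  set a : Fin d → ℝ := expect P (fun ω j => max 0 (X ω j - μ j)) with ha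
  -- A centered variable has positive and negative parts of equal mean. This is needed because the
  -- upper bound on `S` arises with the positive part whereas `β` is defined with the negative one,
  -- and vice versa for `α`.
  have hab : expect P (fun ω j => max 0 (-(X ω j - μ j))) = a := by
    funext j
    have h1 : Integrable (fun ω => max 0 (X ω j - μ j)) P := by
      simpa only [max_comm] using (hXc j).pos_part
    have h2 : Integrable (fun ω => max 0 (-(X ω j - μ j))) P := by
      simpa only [max_comm] using (hXc j).neg_part
    have h3 := integral_sub h1 h2
    have h4 : ∀ ω, max 0 (X ω j - μ j) - max 0 (-(X ω j - μ j)) = X ω j - μ j := by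
      intro ω
      rcases le_total 0 (X ω j - μ j) with h | h
      · rw [max_eq_right h, max_eq_left (by linarith)]; ring
      · rw [max_eq_left h, max_eq_right (by linarith)]; ring
    simp only [h4, hXc0 j] at h3
    simp only [ha, expect]
    linarith
  have hplus : ∀ j i, ∫ ω, max 0 (Xs i ω j - μ j) ∂P = a j := fun j i =>
    ((hid j i).comp (u := fun x => max 0 x) (measurable_const.max measurable_id)).integral_eq
  have hminus : ∀ j i, ∫ ω, max 0 (-(Xs i ω j - μ j)) ∂P = a j := fun j i => by
    rw [← hab]
    exact ((hid j i).comp (u := fun x => max 0 (-x))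
      (measurable_const.max measurable_neg)).integral_eq
  rw [hab] at hβ hη
  have ha0 : ∀ j, 0 ≤ a j := fun j => integral_nonneg fun ω => le_max_left _ _
  have hMint : ∀ k, Integrable (fun ω => (Ns (lastStage Ns R Xs k ω) : ℝ)) P := fun k =>
    integrable_comp_lastStage hmono hRmeas hXs (fun l _ => (Ns l : ℝ))
      (fun l => integrable_const _) k
  have hcenter : ∀ j (l : ℕ) ω, ∑ i ∈ Finset.range l, (Xs i ω j - μ j) =
      sampleSum Xs l ω j - l * μ j := by
    intro j l ω
    simp [sampleSum, Finset.sum_sub_distrib]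
  have hSint : ∀ k j, Integrable
      (fun ω => sampleSum Xs (Ns (lastStage Ns R Xs k ω)) ω j) P := by
    intro k j
    refine integrable_comp_lastStage hmono hRmeas hXs (fun l ω => sampleSum Xs (Ns l) ω j) ?_ k
    intro l
    have h1 : (fun ω => sampleSum Xs (Ns l) ω j) = fun ω =>
        ∑ i ∈ Finset.range (Ns l), (Xs i ω j - μ j) + Ns l * μ j := by
      funext ω
      rw [hcenter, sub_add_cancel]
    rw [h1]
    exact (integrable_finsetSum _ fun i _ => hXsc j i).add (integrable_const _)
  have hcoord : ∀ j, Measurable fun x : Fin d → ℝ => x j - μ j := fun j =>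
    (measurable_pi_apply j).sub_const _
  have hbound : ∀ k j,
      |∫ ω, sampleSum Xs (Ns (lastStage Ns R Xs k ω)) ω j ∂P -
        (∫ ω, (Ns (lastStage Ns R Xs k ω) : ℝ) ∂P) * μ j| ≤
      a j * (lam * (∫ ω, (Ns (lastStage Ns R Xs k ω) : ℝ) ∂P) + K - Ns 0) := by
    intro k j
    have hT := integral_lastStage_succ_le (P := P) hmono hRmeas hXs hI k
    have hT' := mul_le_mul_of_nonneg_left (sub_le_sub_right hT (Ns 0 : ℝ)) (ha0 j)
    have hu := integral_sum_lastStage_le hmono hRmeas hXs hindep (hcoord j) (hXsc j)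
      (hXsc0 j) (hplus j) k
    have hl := integral_sum_lastStage_le hmono hRmeas hXs hindep (hcoord j).neg
      (fun i => (hXsc j i).neg)
      (fun i => by simp only [Pi.neg_apply, integral_neg, hXsc0, neg_zero]) (hminus j) k
    simp only [Pi.neg_apply, Finset.sum_neg_distrib, hcenter, integral_neg] at hl
    simp only [hcenter] at hu
    rw [integral_sub (hSint k j) ((hMint k).mul_const _), integral_mul_const] at hu hl
    rw [abs_le]
    constructor <;> linarith
  have hEle : ∀ k, A ⬝ᵥ (fun j => ∫ ω, sampleSum Xs (Ns (lastStage Ns R Xs k ω)) ω j ∂P) +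
      B * ∫ ω, (Ns (lastStage Ns R Xs k ω) : ℝ) ∂P ≤ C := by
    intro k
    have hS : Integrable
        (fun ω => A ⬝ᵥ sampleSum Xs (Ns (lastStage Ns R Xs k ω)) ω) P :=
      integrable_finsetSum _ fun j _ => (hSint k j).const_mul (A j)
    have h1 : A ⬝ᵥ (fun j => ∫ ω, sampleSum Xs (Ns (lastStage Ns R Xs k ω)) ω j ∂P) =
        ∫ ω, A ⬝ᵥ sampleSum Xs (Ns (lastStage Ns R Xs k ω)) ω ∂P := by
      simp only [dotProduct]
      rw [integral_finsetSum _ fun j _ => (hSint k j).const_mul (A j)]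
      simp only [integral_const_mul]
    rw [h1, ← integral_const_mul, ← integral_add hS ((hMint k).const_mul B)]
    calc
      _ ≤ ∫ _, C ∂P := by
        refine integral_mono_ae (hS.add ((hMint k).const_mul B)) (integrable_const C) ?_
        filter_upwards [hIV] with ω hω
        refine hle (_, _) ?_
        -- Survival says nothing about stage `0`; there the starting assumption `hIV` supplies
        -- membership in the closure.
        rcases Nat.eq_zero_or_pos (lastStage Ns R Xs k ω) with h | h
        · rw [h]
          exact hω
        · exact subset_closure (mem_survivalSet_lastStage Ns R Xs k ω _ h le_rfl)
      _ = C := by simp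
  set D : ℝ := (cubeVertices d).sup' (cubeVertices_nonempty d)
    (fun q => (C - A ⬝ᵥ (η + q * (ζ - η))) / (B + A ⬝ᵥ (β + q * (α - β)))) with hD
  have hMD : ∀ k, ∫ ω, (Ns (lastStage Ns R Xs k ω) : ℝ) ∂P ≤ D := by
    intro k
    obtain ⟨q, hq, hqle⟩ := exists_cubeVertices_dotProduct_le A α β ζ η
    have h1 := hqle (∫ ω, (Ns (lastStage Ns R Xs k ω) : ℝ) ∂P)
      (fun j => ∫ ω, sampleSum Xs (Ns (lastStage Ns R Xs k ω)) ω j ∂P)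
      (fun j => by
        have := (abs_le.1 (hbound k j)).1
        simp only [hα, hζ, Pi.sub_apply, Pi.smul_apply, smul_eq_mul]
        linarith)
      (fun j => by
        have := (abs_le.1 (hbound k j)).2
        simp only [hβ, hη, Pi.add_apply, Pi.smul_apply, smul_eq_mul]
        linarith)
    have h2 : 0 < B + A ⬝ᵥ (β + q * (α - β)) := (Finset.lt_inf'_iff _).1 hpos q hq
    refine le_trans ?_ (Finset.le_sup' (fun q =>
      (C - A ⬝ᵥ (η + q * (ζ - η))) / (B + A ⬝ᵥ (β + q * (α - β)))) hq)
    rw [le_div_iff₀ h2]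
    have := hEle k
    linarith
  -- Nonnegativity ensures that `ENNReal.ofReal D` does not truncate `D`.
  have hD0 : 0 ≤ D := (integral_nonneg fun ω => Nat.cast_nonneg _).trans (hMD 0)
  have hlint : ∫⁻ ω, (lastBefore Ns R Xs ω : ℝ≥0∞) ∂P ≤ ENNReal.ofReal D := by
    simp only [lastBefore_eq_iSup hNs, ENat.toENNReal_iSup, ENat.toENNReal_coe]
    rw [lintegral_iSup]
    · refine iSup_le fun k => ?_
      have h1 := ofReal_integral_eq_lintegral_ofReal (hMint k)
        (ae_of_all _ fun ω => Nat.cast_nonneg _)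
      simp only [ENNReal.ofReal_natCast] at h1
      rw [← h1]
      exact ENNReal.ofReal_le_ofReal (hMD k)
    · exact fun k => (measurable_from_nat (f := fun l => (Ns l : ℝ≥0∞))).comp
        (measurable_lastStage hmono hRmeas hXs k)
    · intro k l hkl ω
      simp only [Nat.cast_le]
      exact hmono (lastStage_monotone Ns R Xs ω hkl)
  calc
    _ ≤ ((ENNReal.ofReal D : ℝ≥0∞) : EReal) := EReal.coe_ennreal_le_coe_ennreal_iff.2 hlint
    _ = (D : EReal) := by rw [EReal.coe_ennreal_ofReal, max_eq_left hD0]
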